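/- **Setting.** For a real random variable $\xi$ let $\|\xi\|_{\psi_2}=\inf\{K>0:\mathbb E\exp(\xi^2/K^2)\le 2\}$, and for a random vector $x\in\mathbb R^d$ let $\|x\|_{\psi_2}=\sup_{\|\theta\|_2\le 1}\|\langle x,\theta\rangle\|_{\psi_2}$. Let $p$ be a sub-Gaussian distribution on $\mathbb R^d$ (that is, $\|x\|_{\psi_2}<\infty$ for $x\sim p$) such that $V_p=\mathbb E_{x\sim p}[xx^\top]$ is positive definite, and let $K=\|V_p^{-1/2}x\|_{\psi_2}$ for $x\sim p$. Let $X\in\mathbb R^{n\times d}$ have i.i.d. rows $x_1,\dots,x_n\sim p$. For $S\subset\{1,\dots,n\}$ with $|S|=k$ let $X_S\in\mathbb R^{k\times d}$ be the submatrix of rows indexed by $S$, and, when $X_S^\top X_S$ is invertible, let $$f_V(X_S)=\Big\langle\big(\tfrac1k X_S^\top X_S\big)^{-1},\tfrac1n X^\top X\Big\rangle,\qquad \langle A,B\rangle=\operatorname{tr}(A^\top B).$$ The observations are $y_S=X_Sw_*+\epsilon_S$ with $w_*\in\mathbb R^d$, where the entries of $\epsilon_S$ are independent with mean $0$ and variance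 $\sigma^2$. The ordinary least squares estimator is $\widehat w\in\arg\min_{w\in\mathbb R^d}\|y_S-X_Sw\|_2^2$, and its excess risk, for given $X$ and $S$, is $$R_p(\widehat w)=\mathbb E_{\epsilon_S,x}\big[(w_*^\top x-\widehat w^\top x)^2\big],$$ where $x\sim p$ is a fresh input independent of $\epsilon_S$. **Proposition 2.1.** For every $K>0$ there is a constant $C>0$, depending only on $K$, such that the following holds for all $d$, $n$ and $p$ as above with $\|V_p^{-1/2}x\|_{\psi_2}=K$ and all $\gamma,\delta\in(0,1)$. If $$n\ \ge\ C\max\Big\{\frac{d}{\gamma^2},\ \frac{\log(2/\delta)}{\gamma^2}\Big\},$$ then with probability at least $1-\delta$ over the draw of $X$, for every $S\subset\{1,\dots,n\}$ with $k=|S|>d$ such that $X^\top X$ and $X_S^\top X_S$ are invertible, and for every $w_*$, every $\sigma$ and all such noise distributions, the expectation defining $R_p(\widehat w)$ is finite and $$\frac{\sigma^2}{(1+\gamma)k}\,f_V(X_S)\ \le\ R_p(\widehat w)\ \le\ \frac{\sigma^2}{(1-\gamma)k}\,f_V(X_S).$$ -/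

import Mathlib

open MeasureTheory ProbabilityTheory
open scoped ENNReal NNReal Matrix

noncomputable section

namespace OptimalDesign

/-! Vectors of `ℝ^d` are functions `Fin d → ℝ`; inner products are `⬝ᵥ`, and Euclidean lengths are
written out through `WithLp.toLp 2` or as sums of squares, so that the sup norm of the function
space plays no role. -/

/-- The `ψ₂`-norm `inf {K > 0 : 𝔼 exp (ξ² / K²) ≤ 2}` of a real random variable, with values in
`[0, ∞]`; it is `∞` when there is no such `K`, that is, when `ξ` is not sub-Gaussian. -/
def psi2Norm {Ω : Type*} [MeasurableSpace Ω] (μ : Measure Ω) (ξ : Ω → ℝ) : ℝ≥0∞ :=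
  ⨅ (K : ℝ≥0) (_ : 0 < K ∧ ∫⁻ ω, ENNReal.ofReal (Real.exp (ξ ω ^ 2 / (K : ℝ) ^ 2)) ∂μ ≤ 2),
    (K : ℝ≥0∞)

/-- The `ψ₂`-norm of a random vector: the supremum over `‖θ‖₂ ≤ 1` of the `ψ₂`-norms of the
marginals `⟨x, θ⟩`. -/
def psi2NormVec {Ω : Type*} [MeasurableSpace Ω] {d : ℕ} (μ : Measure Ω) (x : Ω → Fin d → ℝ) :
    ℝ≥0∞ :=
  ⨆ (θ : Fin d → ℝ) (_ : ‖WithLp.toLp 2 θ‖ ≤ 1), psi2Norm μ (fun ω => x ω ⬝ᵥ θ)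

/-- The matrix `V_p = 𝔼_{x ∼ p} [x xᵀ]`. -/
def secondMoment {d : ℕ} (p : Measure (Fin d → ℝ)) : Matrix (Fin d) (Fin d) ℝ :=
  Matrix.of fun i j => ∫ x, x i * x j ∂p

/-- The inverse square root `A^{-1/2}`, the inverse of the positive semidefinite square root of `A`
(used for positive definite `A`). -/
def invSqrt {d : ℕ} (A : Matrix (Fin d) (Fin d) ℝ) : Matrix (Fin d) (Fin d) ℝ :=
  (open scoped MatrixOrder in CFC.sqrt A)⁻¹

/-- `p` is a sub-Gaussian distribution on `ℝ^d` whose matrix `𝔼 [x xᵀ]` is positive definite. -/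
structure IsSubGaussianInput {d : ℕ} (p : Measure (Fin d → ℝ)) : Prop where
  isProbabilityMeasure : IsProbabilityMeasure p
  subGaussian : psi2NormVec p (fun x => x) < ∞
  posDef : (secondMoment p).PosDef

/-- The submatrix `X_S` formed by the rows of `X` with index in `S`. -/
def selectRows {n d : ℕ} (X : Matrix (Fin n) (Fin d) ℝ) (S : Finset (Fin n)) :
    Matrix S (Fin d) ℝ :=
  X.submatrix (fun i : S => (i : Fin n)) id

/-- The inner product `⟨A, B⟩ = tr (Aᵀ B)` of matrices. -/
def matrixInner {d : ℕ} (A B : Matrix (Fin d) (Fin d) ℝ) : ℝ :=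
  (Aᵀ * B).trace

/-- The V-optimal design objective `f_V(X_S) = ⟨(X_Sᵀ X_S / k)⁻¹, Xᵀ X / n⟩`, `k = |S|`. -/
def vObjective {n d : ℕ} (X : Matrix (Fin n) (Fin d) ℝ) (S : Finset (Fin n)) : ℝ :=
  matrixInner ((1 / (S.card : ℝ)) • ((selectRows X S)ᵀ * selectRows X S))⁻¹
    ((1 / (n : ℝ)) • (Xᵀ * X))

/-- `ρ` is the law of a noise variable `ε` with `𝔼 ε = 0` and `𝔼 ε² = σ²`. -/
structure IsNoiseLaw (σ : ℝ) (ρ : Measure ℝ) : Prop where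
  isProbabilityMeasure : IsProbabilityMeasure ρ
  memLp : MemLp (fun e : ℝ => e) 2 ρ
  mean : ∫ e, e ∂ρ = 0
  variance : ∫ e, e ^ 2 ∂ρ = σ ^ 2

/-- `What` maps each vector `y` of observations to a minimizer of `w ↦ ‖y - A w‖₂²`: it is an
ordinary least squares estimator for the design matrix `A`. -/
def IsOLSEstimator {ι : Type*} [Fintype ι] {d : ℕ} (A : Matrix ι (Fin d) ℝ)
    (What : (ι → ℝ) → Fin d → ℝ) : Prop :=
  ∀ (y : ι → ℝ) (w : Fin d → ℝ),
    ∑ i, (y i - (A *ᵥ What y) i) ^ 2 ≤ ∑ i, (y i - (A *ᵥ w) i) ^ 2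

/-- The squared prediction error `(wᵀ x - ŵᵀ x)²` at a fresh input `x = z.2`, where
`ŵ = What (A w + ε)` is computed from the observations with noise vector `ε = z.1`. -/
def predictionError {ι : Type*} {d : ℕ} (A : Matrix ι (Fin d) ℝ) (w : Fin d → ℝ)
    (What : (ι → ℝ) → Fin d → ℝ) (z : (ι → ℝ) × (Fin d → ℝ)) : ℝ :=
  (w ⬝ᵥ z.2 - What (A *ᵥ w + z.1) ⬝ᵥ z.2) ^ 2

/-- The joint law of a noise vector with independent entries `ε_i ∼ ρ i` and of a fresh input
`x ∼ p` that is independent of it. -/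
def noiseInputLaw {ι : Type*} [Fintype ι] {d : ℕ} (ρ : ι → Measure ℝ) (p : Measure (Fin d → ℝ)) :
    Measure ((ι → ℝ) × (Fin d → ℝ)) :=
  (Measure.pi ρ).prod p

/-- The excess risk `R_p(ŵ) = 𝔼_{ε, x} [(wᵀ x - ŵᵀ x)²]` for the design matrix `A`. -/
def excessRisk {ι : Type*} [Fintype ι] {d : ℕ} (p : Measure (Fin d → ℝ)) (ρ : ι → Measure ℝ)
    (A : Matrix ι (Fin d) ℝ) (w : Fin d → ℝ) (What : (ι → ℝ) → Fin d → ℝ) : ℝ :=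
  ∫ z, predictionError A w What z ∂(noiseInputLaw ρ p)

end OptimalDesign

end

/-! Write `A` for `X_S` and `g_i` for the columns of the pseudo-inverse `(AᵀA)⁻¹Aᵀ`. The error of
least squares is the noise pushed through this pseudo-inverse, so independence and centring give
`R_p(ŵ) = σ² T` with `T = ∑ g_iᵀ V_p g_i` (`IsOLSEstimator.excessRisk_eq`). The design objective is
the same sum with `XᵀX` in place of `V_p`: `f_V(X_S) = (k/n) U` with `U = ∑ g_iᵀ XᵀX g_i`
(`vObjective_eq`).

It remains to compare the quadratic forms of `XᵀX` and `n V_p`. With high probability they agree up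
to the factors `1 ± γ` in every direction at once (`exists_event_secondMoment_le`). This event
concerns the full matrix `X` only, so it may be applied to the data-dependent vectors `g_i`, and no
union bound over the subsets `S` is needed.

For the concentration, whiten the rows by `V_p^{-1/2}`, so that the target becomes the identity. In
a fixed direction the deviation is a sum of centred squares of sub-Gaussian variables, controlled by
a Chernoff bound; a union bound over a `1/4`-net of at most `9^d` points then reaches all
directions. -/

namespace OptimalDesign

/-! ### Nets of the unit ball and quadratic forms -/

section Net

open Metric Set Module

/-- Volume bound for a `1`-separated subset of the ball of radius `4`. -/
theorem card_le_nine_pow_of_separated {E : Type*} [NormedAddCommGroup E] [NormedSpace ℝ E]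
    [FiniteDimensional ℝ E] (s : Finset E) (hs : ∀ c ∈ s, ‖c‖ ≤ 4)
    (h : ∀ c ∈ s, ∀ d ∈ s, c ≠ d → 1 ≤ ‖c - d‖) : s.card ≤ 9 ^ finrank ℝ E := by
  borelize E
  let μ : Measure E := Measure.addHaar
  have D : Set.Pairwise (s : Set E) (Function.onFun Disjoint fun c => ball (c : E) (1 / 2)) := by
    rintro c hc d hd hcd
    apply ball_disjoint_ball
    rw [dist_eq_norm]
    linarith [h c hc d hd hcd]
  have hsub : (⋃ c ∈ s, ball (c : E) (1 / 2)) ⊆ ball (0 : E) (9 / 2) := by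
    refine iUnion₂_subset fun x hx => ball_subset_ball' ?_
    rw [dist_zero_right]
    linarith [hs x hx]
  have I : (s.card : ℝ≥0∞) * ENNReal.ofReal ((1 / 2) ^ finrank ℝ E) * μ (ball 0 1) ≤
      ENNReal.ofReal ((9 / 2) ^ finrank ℝ E) * μ (ball 0 1) :=
    calc
      _ = μ (⋃ c ∈ s, ball (c : E) (1 / 2)) := by
        rw [measure_biUnion_finset D fun c _ => measurableSet_ball]
        have I : (0 : ℝ) < 1 / 2 := by norm_num
        simp only [μ.addHaar_ball_of_pos _ I, Finset.sum_const, nsmul_eq_mul, mul_assoc]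
      _ ≤ μ (ball (0 : E) (9 / 2)) := measure_mono hsub
      _ = _ := μ.addHaar_ball_of_pos _ (by norm_num)
  have J := (ENNReal.mul_le_mul_iff_left (measure_ball_pos μ (0 : E) zero_lt_one).ne'
    measure_ball_lt_top.ne).1 I
  have K : (s.card : ℝ) ≤ (9 : ℝ) ^ finrank ℝ E := by
    have := ENNReal.toReal_le_of_le_ofReal (by positivity) J
    simpa [div_eq_mul_inv, mul_pow] using this
  exact mod_cast K

/-- A maximal `1/4`-separated subset of the unit ball is a `1/4`-net, since any uncovered point
could be added to it; the volume bound limits its size. -/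
theorem exists_quarter_net (d : ℕ) : ∃ N : Finset (Fin d → ℝ), N.card ≤ 9 ^ d ∧
    (∀ y ∈ N, y ⬝ᵥ y ≤ 1) ∧
    ∀ x : Fin d → ℝ, x ⬝ᵥ x ≤ 1 → ∃ y ∈ N, (x - y) ⬝ᵥ (x - y) ≤ 1 / 16 := by
  classical
  let A : Set (EuclideanSpace ℝ (Fin d)) := closedBall 0 1
  let ε : ℝ≥0 := 1 / 4
  have hnorm : ∀ x : EuclideanSpace ℝ (Fin d), ‖x‖ ^ 2 = x.ofLp ⬝ᵥ x.ofLp := by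
    intro x
    rw [EuclideanSpace.norm_sq_eq]
    simp [dotProduct, sq]
  have hcard : ∀ s : Finset (EuclideanSpace ℝ (Fin d)), (s : Set _) ⊆ A →
      IsSeparated ε (s : Set (EuclideanSpace ℝ (Fin d))) → s.card ≤ 9 ^ d := by
    intro s hs hsep
    -- Dilation by 4 turns a `1/4`-separated subset of the unit ball into a `1`-separated subset of
    -- the ball of radius 4.
    have h4 : Function.Injective fun x : EuclideanSpace ℝ (Fin d) => (4 : ℝ) • x :=
      smul_right_injective _ (by norm_num)
    rw [← Finset.card_image_of_injective s h4]
    have := card_le_nine_pow_of_separated (s.image fun x => (4 : ℝ) • x) ?_ ?_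
    · simpa using this
    · simp only [Finset.mem_image]
      rintro _ ⟨x, hx, rfl⟩
      have : ‖x‖ ≤ 1 := by simpa [A] using hs hx
      rw [norm_smul]; norm_num; linarith
    · simp only [Finset.mem_image]
      rintro _ ⟨x, hx, rfl⟩ _ ⟨y, hy, rfl⟩ hxy
      have hne : x ≠ y := fun h => hxy (by rw [h])
      have : (ε : ℝ≥0∞) < edist x y := hsep hx hy hne
      rw [edist_dist, dist_eq_norm, ← ENNReal.ofReal_coe_nnreal,
        ENNReal.ofReal_lt_ofReal_iff_of_nonneg (by positivity)] at this
      rw [← smul_sub, norm_smul]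
      have h2 : ((ε : ℝ≥0) : ℝ) = 1 / 4 := by simp [ε]
      rw [h2] at this
      norm_num; linarith
  have hpack : packingNumber ε A ≤ (9 ^ d : ℕ) := by
    refine iSup_le fun C => iSup_le fun hC => iSup_le fun hsep => ?_
    by_contra hlt
    rw [not_le] at hlt
    -- A separated set might be infinite, so a subset of exactly `9 ^ d + 1` points is extracted to
    -- contradict the finite bound.
    obtain ⟨t, htC, ht⟩ := Set.exists_subset_encard_eq (Order.add_one_le_of_lt hlt)
    have htf : t.Finite := Set.finite_of_encard_eq_coe (k := 9 ^ d + 1) (by simpa using ht)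
    have := hcard htf.toFinset (by simpa using htC.trans hC) (by simpa using hsep.subset htC)
    rw [htf.encard_eq_coe_toFinset_card] at ht
    have h3 : htf.toFinset.card = 9 ^ d + 1 := by exact_mod_cast ht
    omega
  have hne : packingNumber ε A ≠ ⊤ := ne_top_of_le_ne_top (ENat.natCast_ne_top _) hpack
  have hcov := isCover_maximalSeparatedSet hne
  have hfin : (maximalSeparatedSet ε A).Finite := by
    apply Set.finite_of_encard_le_coe (k := 9 ^ d)
    rw [encard_maximalSeparatedSet hne]; exact hpack
  refine ⟨hfin.toFinset.image WithLp.ofLp, ?_, ?_, ?_⟩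
  · refine Finset.card_image_le.trans (hcard _ ?_ ?_)
    · simpa using maximalSeparatedSet_subset
    · simpa using isSeparated_maximalSeparatedSet
  · simp only [Finset.mem_image, Set.Finite.mem_toFinset]
    rintro _ ⟨y, hy, rfl⟩
    have : ‖y‖ ≤ 1 := by simpa [A] using maximalSeparatedSet_subset hy
    rw [← hnorm]
    exact pow_le_one₀ (norm_nonneg _) this
  · intro x hx
    have hxA : WithLp.toLp 2 x ∈ A := by
      have := hnorm (WithLp.toLp 2 x)
      simp only [A, mem_closedBall, dist_zero_right]
      rw [← sq_le_one_iff₀ (norm_nonneg _), this]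
      exact hx
    obtain ⟨y, hy, hxy⟩ := hcov hxA
    refine ⟨y.ofLp, by simpa using ⟨y, hy, rfl⟩, ?_⟩
    have h1 : ‖WithLp.toLp 2 x - y‖ ≤ 1 / 4 := by
      rw [← dist_eq_norm]
      have : edist (WithLp.toLp 2 x) y ≤ ε := hxy
      rw [edist_dist, ← ENNReal.ofReal_coe_nnreal, ENNReal.ofReal_le_ofReal_iff (by positivity)]
        at this
      simpa [ε] using this
    have h2 := hnorm (WithLp.toLp 2 x - y)
    simp only [WithLp.ofLp_sub] at h2
    rw [← h2]
    nlinarith [norm_nonneg (WithLp.toLp 2 x - y)]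

end Net

/-- A symmetric quadratic form that is small on a `1/4`-net of the unit ball is small. -/
theorem abs_quadForm_le_of_net {d : ℕ} {M : Matrix (Fin d) (Fin d) ℝ} (hM : Mᵀ = M)
    {N : Finset (Fin d → ℝ)} (hN : ∀ y ∈ N, y ⬝ᵥ y ≤ 1)
    (hcov : ∀ x : Fin d → ℝ, x ⬝ᵥ x ≤ 1 → ∃ y ∈ N, (x - y) ⬝ᵥ (x - y) ≤ 1 / 16)
    {t : ℝ} (ht : ∀ y ∈ N, |y ⬝ᵥ M *ᵥ y| ≤ t) (θ : Fin d → ℝ) :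
    |θ ⬝ᵥ M *ᵥ θ| ≤ 3 * t * (θ ⬝ᵥ θ) := by
  have hnn : ∀ u : Fin d → ℝ, 0 ≤ u ⬝ᵥ u := fun u => by
    simpa using dotProduct_star_self_nonneg u
  have hsymm : ∀ u v : Fin d → ℝ, u ⬝ᵥ M *ᵥ v = v ⬝ᵥ M *ᵥ u := fun u v => by
    rw [Matrix.dotProduct_mulVec, dotProduct_comm, ← Matrix.mulVec_transpose, hM]
  let B : Set (Fin d → ℝ) := {u | u ⬝ᵥ u ≤ 1}
  have hB : IsCompact B := by
    refine Metric.isCompact_of_isClosed_isBounded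
      (isClosed_le (by unfold dotProduct; fun_prop) continuous_const) ?_
    refine (Metric.isBounded_closedBall (x := (0 : Fin d → ℝ)) (r := 1)).subset fun u hu => ?_
    rw [mem_closedBall_zero_iff, pi_norm_le_iff_of_nonneg zero_le_one]
    intro i
    have h1 : u i * u i ≤ u ⬝ᵥ u :=
      Finset.single_le_sum (f := fun i => u i * u i) (fun i _ => mul_self_nonneg _)
        (Finset.mem_univ i)
    have h2 : u ⬝ᵥ u ≤ 1 := hu
    rw [Real.norm_eq_abs, abs_le]
    constructor <;> nlinarith
  -- The form attains its maximum modulus `a` over the unit ball at `x`. Comparing `x` with a nearby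
  -- net point bounds `a` by a fraction of itself plus `t`.
  obtain ⟨x, hx, hmax⟩ := hB.exists_isMaxOn ⟨0, by simp [B]⟩
    (f := fun u => |u ⬝ᵥ M *ᵥ u|)
    (by simp only [dotProduct, Matrix.mulVec]; fun_prop)
  set a := |x ⬝ᵥ M *ᵥ x| with ha
  have ha0 : 0 ≤ a := abs_nonneg _
  have hle : ∀ u : Fin d → ℝ, |u ⬝ᵥ M *ᵥ u| ≤ a * (u ⬝ᵥ u) := by
    intro u
    rcases (hnn u).eq_or_lt with h0 | h0
    · have : u = 0 := dotProduct_self_eq_zero.1 h0.symm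
      simp [this]
    · have hs : √(u ⬝ᵥ u) ≠ 0 := (Real.sqrt_pos.2 h0).ne'
      have hss : √(u ⬝ᵥ u) * √(u ⬝ᵥ u) = u ⬝ᵥ u := Real.mul_self_sqrt h0.le
      have hmem : (√(u ⬝ᵥ u))⁻¹ • u ∈ B := by
        simp only [B, Set.mem_ofPred_eq, smul_dotProduct, dotProduct_smul, smul_eq_mul]
        rw [← mul_assoc, ← mul_inv, hss, inv_mul_cancel₀ h0.ne']
      have := hmax hmem
      simp only [Set.mem_ofPred_eq, Matrix.mulVec_smul, smul_dotProduct, dotProduct_smul,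
        smul_eq_mul] at this
      rw [← mul_assoc, ← mul_inv, hss, abs_mul, abs_of_pos (inv_pos.2 h0),
        inv_mul_le_iff₀ h0] at this
      linarith
  have hpol : ∀ u v : Fin d → ℝ, |u ⬝ᵥ M *ᵥ v| ≤ a * (u ⬝ᵥ u + v ⬝ᵥ v) / 2 := by
    intro u v
    have h1 := abs_le.1 (hle (u + v))
    have h2 := abs_le.1 (hle (u - v))
    have h3 := hsymm u v
    have h4 := dotProduct_comm u v
    simp only [Matrix.mulVec_add, Matrix.mulVec_sub, dotProduct_add, add_dotProduct,
      dotProduct_sub, sub_dotProduct] at h1 h2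
    rw [← h3, ← h4] at h1 h2
    rw [abs_le]
    constructor <;> nlinarith
  obtain ⟨y, hy, hxy⟩ := hcov x hx
  have hdiff : x ⬝ᵥ M *ᵥ x - y ⬝ᵥ M *ᵥ y = (x - y) ⬝ᵥ M *ᵥ (x + y) := by
    have := hsymm x y
    simp only [Matrix.mulVec_add, dotProduct_add, sub_dotProduct]
    linarith
  have hsum : (x + y) ⬝ᵥ (x + y) ≤ 4 := by
    have h1 := hnn (x - y)
    have h2 := hN y hy
    have h3 : x ⬝ᵥ x ≤ 1 := hx
    simp only [dotProduct_add, add_dotProduct, dotProduct_sub, sub_dotProduct] at h1 ⊢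
    linarith
  -- The weights 3 and 1/3 nearly balance `‖x - y‖ ≤ 1/4` against `‖x + y‖ ≤ 2`: the squares add up
  -- to at most 9/16 + 4/9 = 145/144. Hence `a ≤ (145/288) a + t`, which gives `a ≤ 3 t`.
  have h3 := hpol ((3 : ℝ) • (x - y)) ((3 : ℝ)⁻¹ • (x + y))
  simp only [Matrix.mulVec_smul, smul_dotProduct, dotProduct_smul, smul_eq_mul] at h3
  rw [← mul_assoc, show (3 : ℝ)⁻¹ * 3 = 1 by norm_num, one_mul, ← hdiff] at h3
  have h4 := ht y hy
  have h5 : a ≤ |x ⬝ᵥ M *ᵥ x - y ⬝ᵥ M *ᵥ y| + |y ⬝ᵥ M *ᵥ y| := by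
    have := abs_add_le (x ⬝ᵥ M *ᵥ x - y ⬝ᵥ M *ᵥ y) (y ⬝ᵥ M *ᵥ y)
    simpa using this
  have h6 : a ≤ 3 * t := by
    have : a * (3 * (3 * ((x - y) ⬝ᵥ (x - y))) + 3⁻¹ * (3⁻¹ * ((x + y) ⬝ᵥ (x + y)))) / 2
        ≤ a * (145 / 144) / 2 := by
      gcongr
      linarith
    linarith
  exact (hle θ).trans (mul_le_mul_of_nonneg_right h6 (hnn θ))

/-! ### Exponential moments and tails of centred squares -/

theorem exp_le_one_add_add_sq_mul_exp_abs (u : ℝ) :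
    Real.exp u ≤ 1 + u + u ^ 2 * Real.exp |u| := by
  have h := Complex.norm_exp_sub_sum_le_norm_mul_exp (u : ℂ) 2
  rw [Finset.sum_range_succ, Finset.sum_range_one] at h
  simp only [pow_zero, Nat.factorial_zero, Nat.cast_one, div_one, pow_one, Nat.factorial_one,
    Complex.norm_real, Real.norm_eq_abs, sq_abs] at h
  rw [← Complex.ofReal_exp, ← Complex.ofReal_one, ← Complex.ofReal_add, ← Complex.ofReal_sub,
    Complex.norm_real, Real.norm_eq_abs] at h
  linarith [le_abs_self (Real.exp u - (1 + u))]

section Scalar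

variable {Ω : Type*} [MeasurableSpace Ω] {μ : Measure Ω} {ξ : Ω → ℝ} {L : ℝ}

theorem integrable_exp_sq_div (hξ : AEMeasurable ξ μ)
    (h2 : ∫⁻ ω, ENNReal.ofReal (Real.exp (ξ ω ^ 2 / L ^ 2)) ∂μ ≤ 2) :
    Integrable (fun ω => Real.exp (ξ ω ^ 2 / L ^ 2)) μ ∧
      ∫ ω, Real.exp (ξ ω ^ 2 / L ^ 2) ∂μ ≤ 2 := by
  have hm : AEStronglyMeasurable (fun ω => Real.exp (ξ ω ^ 2 / L ^ 2)) μ := by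
    apply AEMeasurable.aestronglyMeasurable
    fun_prop
  refine ⟨⟨hm, ?_⟩, ?_⟩
  · rw [hasFiniteIntegral_iff_ofReal (ae_of_all _ fun ω => (Real.exp_pos _).le)]
    exact h2.trans_lt (by simp)
  · rw [integral_eq_lintegral_of_nonneg_ae (ae_of_all _ fun ω => (Real.exp_pos _).le) hm]
    exact ENNReal.toReal_le_of_le_ofReal (by norm_num) (by simpa using h2)

theorem integrable_sq_of_psi2 (hL : 0 < L) (hξ : AEMeasurable ξ μ)
    (h2 : ∫⁻ ω, ENNReal.ofReal (Real.exp (ξ ω ^ 2 / L ^ 2)) ∂μ ≤ 2) :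
    Integrable (fun ω => ξ ω ^ 2) μ := by
  refine ((integrable_exp_sq_div hξ h2).1.const_mul (L ^ 2)).mono'
    (hξ.pow_const 2).aestronglyMeasurable (ae_of_all _ fun ω => ?_)
  rw [Real.norm_eq_abs, abs_of_nonneg (sq_nonneg _), ← div_le_iff₀' (by positivity)]
  linarith [Real.add_one_le_exp (ξ ω ^ 2 / L ^ 2)]

/-- The centred square of a sub-Gaussian variable is sub-exponential. -/
theorem mgf_sq_sub_le [IsProbabilityMeasure μ] (hL : 1 ≤ L) (hξ : AEMeasurable ξ μ)
    (h2 : ∫⁻ ω, ENNReal.ofReal (Real.exp (ξ ω ^ 2 / L ^ 2)) ∂μ ≤ 2)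
    {c : ℝ} (hc : ∫ ω, ξ ω ^ 2 ∂μ = c) (hc1 : c ≤ 1) {l : ℝ} (hl : |l| * L ^ 2 ≤ 1 / 2) :
    Integrable (fun ω => Real.exp (l * (ξ ω ^ 2 - c))) μ ∧
      mgf (fun ω => ξ ω ^ 2 - c) μ l ≤ Real.exp (44 * L ^ 4 * l ^ 2) := by
  obtain ⟨hE, hE2⟩ := integrable_exp_sq_div hξ h2
  have hS := integrable_sq_of_psi2 (by linarith) hξ h2
  have hc0 : 0 ≤ c := hc ▸ integral_nonneg fun ω => sq_nonneg _
  -- The linear Taylor term is kept exact because it integrates to zero. With `W = ξ²/L²`, the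
  -- remainder `u² exp |u|` is at most `l² L⁴ (W+1)² exp ((W+1)/2)`. From `(W+1)² ≤ 8 exp ((W+1)/2)`
  -- and `e ≤ 2.75` comes 22 = 8 · 2.75; the bound 2 on the mean of `exp W` then doubles it to 44.
  have hpt : ∀ ω, Real.exp (l * (ξ ω ^ 2 - c)) ≤
      1 + l * (ξ ω ^ 2 - c) + 22 * L ^ 4 * l ^ 2 * Real.exp (ξ ω ^ 2 / L ^ 2) := by
    intro ω
    set W := ξ ω ^ 2 / L ^ 2 with hW
    have hW0 : 0 ≤ W := by positivity
    have hLW : ξ ω ^ 2 = L ^ 2 * W := by rw [hW]; field_simp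
    set u := l * (ξ ω ^ 2 - c) with hu
    have hua : |u| ≤ |l| * L ^ 2 * (W + 1) := by
      rw [hu, abs_mul, mul_assoc]
      gcongr
      rw [hLW, abs_le]
      have : 1 ≤ L ^ 2 := one_le_pow₀ hL
      have : 0 ≤ L ^ 2 * W := by positivity
      constructor <;> nlinarith
    have hu2 : u ^ 2 ≤ l ^ 2 * L ^ 4 * (W + 1) ^ 2 := by
      calc u ^ 2 = |u| ^ 2 := (sq_abs u).symm
        _ ≤ (|l| * L ^ 2 * (W + 1)) ^ 2 := by gcongr
        _ = _ := by rw [mul_pow, mul_pow, sq_abs]; ring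
    have hu3 : |u| ≤ (W + 1) / 2 := hua.trans (by nlinarith)
    have hq : (W + 1) ^ 2 ≤ 8 * Real.exp ((W + 1) / 2) := by
      have := Real.quadratic_le_exp_of_nonneg (x := (W + 1) / 2) (by positivity)
      nlinarith
    have he : Real.exp ((W + 1) / 2) * Real.exp ((W + 1) / 2) ≤ 2.75 * Real.exp W := by
      rw [← Real.exp_add, add_halves, add_comm, Real.exp_add]
      gcongr
      linarith [Real.exp_one_lt_d9]
    calc Real.exp u ≤ 1 + u + u ^ 2 * Real.exp |u| := exp_le_one_add_add_sq_mul_exp_abs u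
      _ ≤ 1 + u + (l ^ 2 * L ^ 4 * (8 * Real.exp ((W + 1) / 2))) * Real.exp ((W + 1) / 2) := by
        gcongr
        exact hu2.trans (by gcongr)
      _ = 1 + u + 8 * (l ^ 2 * L ^ 4) *
          (Real.exp ((W + 1) / 2) * Real.exp ((W + 1) / 2)) := by ring
      _ ≤ 1 + u + 8 * (l ^ 2 * L ^ 4) * (2.75 * Real.exp W) := by gcongr
      _ = _ := by ring
  have hYint : Integrable (fun ω => l * (ξ ω ^ 2 - c)) μ :=
    (hS.sub (integrable_const c)).const_mul l
  have hY1 : Integrable (fun ω => 1 + l * (ξ ω ^ 2 - c)) μ := (integrable_const 1).add hYint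
  have hR : Integrable (fun ω => 1 + l * (ξ ω ^ 2 - c) +
      22 * L ^ 4 * l ^ 2 * Real.exp (ξ ω ^ 2 / L ^ 2)) μ := hY1.add (hE.const_mul _)
  have hI : Integrable (fun ω => Real.exp (l * (ξ ω ^ 2 - c))) μ := by
    refine hR.mono' (AEMeasurable.aestronglyMeasurable (by fun_prop)) (ae_of_all _ fun ω => ?_)
    rw [Real.norm_eq_abs, abs_of_pos (Real.exp_pos _)]
    exact hpt ω
  refine ⟨hI, ?_⟩
  calc mgf (fun ω => ξ ω ^ 2 - c) μ l
      ≤ ∫ ω, 1 + l * (ξ ω ^ 2 - c) + 22 * L ^ 4 * l ^ 2 * Real.exp (ξ ω ^ 2 / L ^ 2) ∂μ :=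
        integral_mono hI hR hpt
    _ = 1 + 22 * L ^ 4 * l ^ 2 * ∫ ω, Real.exp (ξ ω ^ 2 / L ^ 2) ∂μ := by
        rw [integral_add hY1 (hE.const_mul _),
          integral_add (integrable_const 1) hYint, integral_const_mul, integral_const_mul,
          integral_sub hS (integrable_const c), hc]
        simp
    _ ≤ 1 + 22 * L ^ 4 * l ^ 2 * 2 := by gcongr
    _ ≤ Real.exp (44 * L ^ 4 * l ^ 2) := by
        linarith [Real.add_one_le_exp (44 * L ^ 4 * l ^ 2)]

/-- Bernstein's inequality for the centred squares of independent sub-Gaussian variables. -/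
theorem measureReal_abs_sum_sq_sub_ge_le {n : ℕ} {ξ : Fin n → Ω → ℝ} [IsProbabilityMeasure μ]
    (hL : 1 ≤ L) (hξ : ∀ i, AEMeasurable (ξ i) μ) (hind : iIndepFun ξ μ)
    (h2 : ∀ i, ∫⁻ ω, ENNReal.ofReal (Real.exp (ξ i ω ^ 2 / L ^ 2)) ∂μ ≤ 2)
    {c : ℝ} (hc : ∀ i, ∫ ω, ξ i ω ^ 2 ∂μ = c) (hc1 : c ≤ 1) {t : ℝ} (ht : 0 ≤ t) (ht1 : t ≤ 1) :
    μ.real {ω | n * t ≤ |∑ i, (ξ i ω ^ 2 - c)|} ≤ 2 * Real.exp (-(n * t ^ 2 / (176 * L ^ 4))) := by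
  have hL4 : 0 < L ^ 4 := by positivity
  set Y : Fin n → Ω → ℝ := fun i ω => ξ i ω ^ 2 - c with hY
  have hYind : iIndepFun Y μ := hind.comp (fun _ x => x ^ 2 - c) fun _ => by fun_prop
  have hYm : ∀ i, AEMeasurable (Y i) μ := fun i => by have := hξ i; fun_prop
  -- This `l` minimizes the Chernoff exponent `-l n t + 44 n L⁴ l²`, with minimum `-n t² / (176
  -- L⁴)`. The assumption `t ≤ 1` keeps it in the range where the moment bound holds.
  set l := t / (88 * L ^ 4) with hl
  have hl0 : 0 ≤ l := by positivity
  have hlL : l * L ^ 2 ≤ 1 / 2 := by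
    have h1 : L ^ 2 ≤ L ^ 4 := pow_le_pow_right₀ hL (by norm_num)
    calc l * L ^ 2 ≤ l * L ^ 4 := by gcongr
      _ = t / 88 := by rw [hl]; field_simp
      _ ≤ 1 / 2 := by linarith
  have hsum : ∀ s : ℝ, |s| = l → Integrable (fun ω => Real.exp (s * (∑ i, Y i) ω)) μ ∧
      mgf (∑ i, Y i) μ s ≤ Real.exp (n * (44 * L ^ 4 * l ^ 2)) := by
    intro s hs
    have hi := fun i => mgf_sq_sub_le hL (hξ i) (h2 i) (hc i) hc1 (l := s) (by rwa [hs])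
    constructor
    -- A non-integrable exponential would make `mgf` take its default value 0, but by independence
    -- it is a product of positive factors.
    · by_contra h
      have h0 := mgf_undef h
      rw [hYind.mgf_sum₀ hYm] at h0
      exact (Finset.prod_pos fun i _ => mgf_pos (hi i).1).ne' h0
    · rw [hYind.mgf_sum₀ hYm]
      calc ∏ i, mgf (Y i) μ s ≤ ∏ _i : Fin n, Real.exp (44 * L ^ 4 * l ^ 2) := by
            refine Finset.prod_le_prod (fun i _ => mgf_nonneg) fun i _ => ?_
            rw [← hs, sq_abs]
            exact (hi i).2
        _ = _ := by simp [← Real.exp_nat_mul]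
  have hexp : Real.exp (-l * (n * t)) * Real.exp (n * (44 * L ^ 4 * l ^ 2)) =
      Real.exp (-(n * t ^ 2 / (176 * L ^ 4))) := by
    rw [← Real.exp_add]
    congr 1
    rw [hl]
    field_simp
    ring
  have hup : μ.real {ω | n * t ≤ (∑ i, Y i) ω} ≤ Real.exp (-(n * t ^ 2 / (176 * L ^ 4))) := by
    obtain ⟨h1, h2⟩ := hsum l (abs_of_nonneg hl0)
    refine (measure_ge_le_exp_mul_mgf (n * t) hl0 h1).trans ?_
    rw [← hexp]
    gcongr
  have hlow : μ.real {ω | (∑ i, Y i) ω ≤ -(n * t)} ≤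
      Real.exp (-(n * t ^ 2 / (176 * L ^ 4))) := by
    obtain ⟨h1, h2⟩ := hsum (-l) (by rw [abs_neg, abs_of_nonneg hl0])
    refine (measure_le_le_exp_mul_mgf (-(n * t)) (neg_nonpos.2 hl0) h1).trans ?_
    rw [← hexp, neg_neg, neg_mul, mul_neg]
    gcongr
  calc μ.real {ω | n * t ≤ |∑ i, (ξ i ω ^ 2 - c)|}
      ≤ μ.real ({ω | n * t ≤ (∑ i, Y i) ω} ∪ {ω | (∑ i, Y i) ω ≤ -(n * t)}) := by
        refine measureReal_mono fun ω hω => ?_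
        simp only [Set.mem_ofPred_eq, Set.mem_union, Finset.sum_apply] at hω ⊢
        rcases le_abs.1 hω with h | h
        · exact Or.inl h
        · exact Or.inr (by linarith)
    _ ≤ _ := (measureReal_union_le _ _).trans (by linarith)

end Scalar

/-! ### Concentration uniformly over directions -/

/-- Concentration of the empirical second moment matrix of isotropic sub-Gaussian vectors. -/
theorem exists_event_empirical_secondMoment {Ω : Type*} [MeasurableSpace Ω] {P : Measure Ω}
    [IsProbabilityMeasure P] {d n : ℕ} {z : Fin n → Ω → Fin d → ℝ}
    (hz : ∀ i, AEMeasurable (z i) P) (hind : iIndepFun z P) {L : ℝ} (hL : 1 ≤ L)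
    (h2 : ∀ i, ∀ θ : Fin d → ℝ, θ ⬝ᵥ θ ≤ 1 →
      ∫⁻ ω, ENNReal.ofReal (Real.exp ((z i ω ⬝ᵥ θ) ^ 2 / L ^ 2)) ∂P ≤ 2)
    (hiso : ∀ i, ∀ θ : Fin d → ℝ, ∫ ω, (z i ω ⬝ᵥ θ) ^ 2 ∂P = θ ⬝ᵥ θ)
    {γ δ : ℝ} (hγ : 0 < γ) (hγ1 : γ < 1) (hδ : 0 < δ)
    (hn : 14256 * L ^ 4 * max ((d : ℝ) / γ ^ 2) (Real.log (2 / δ) / γ ^ 2) ≤ n) :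
    ∃ E : Set Ω, MeasurableSet E ∧ ENNReal.ofReal (1 - δ) ≤ P E ∧
      ∀ ω ∈ E, ∀ θ : Fin d → ℝ, |∑ i, (z i ω ⬝ᵥ θ) ^ 2 - n * (θ ⬝ᵥ θ)| ≤ n * γ * (θ ⬝ᵥ θ) := by
  obtain ⟨N, hNcard, hN, hcov⟩ := exists_quarter_net d
  have hL4 : 0 < L ^ 4 := by positivity
  -- The threshold `γ / 3` compensates for the factor 3 lost in passing from the net to the ball.
  let bad : (Fin d → ℝ) → Set Ω := fun y =>
    {ω | n * (γ / 3) ≤ |∑ i, ((z i ω ⬝ᵥ y) ^ 2 - y ⬝ᵥ y)|}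
  have hbad : ∀ y ∈ N, P.real (bad y) ≤ 2 * Real.exp (-(n * (γ / 3) ^ 2 / (176 * L ^ 4))) := by
    intro y hy
    refine measureReal_abs_sum_sq_sub_ge_le (ξ := fun i ω => z i ω ⬝ᵥ y) hL (fun i => ?_) ?_
      (fun i => h2 i y (hN y hy)) (fun i => hiso i y) (hN y hy) (by positivity) (by linarith)
    · have := hz i
      unfold dotProduct
      fun_prop
    · exact hind.comp (fun _ v => v ⬝ᵥ y) fun _ => by unfold dotProduct; fun_prop
  let B : Set Ω := ⋃ y ∈ N, bad y
  have hB : P.real B ≤ δ := by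
    have h1 : 14256 * L ^ 4 * d ≤ n * γ ^ 2 := by
      have := (mul_le_mul_of_nonneg_left (le_max_left ((d : ℝ) / γ ^ 2)
        (Real.log (2 / δ) / γ ^ 2)) (by positivity : 0 ≤ 14256 * L ^ 4)).trans hn
      rwa [← mul_div_assoc, div_le_iff₀ (by positivity)] at this
    have h3 : 14256 * L ^ 4 * Real.log (2 / δ) ≤ n * γ ^ 2 := by
      have := (mul_le_mul_of_nonneg_left (le_max_right ((d : ℝ) / γ ^ 2)
        (Real.log (2 / δ) / γ ^ 2)) (by positivity : 0 ≤ 14256 * L ^ 4)).trans hn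
      rwa [← mul_div_assoc, div_le_iff₀ (by positivity)] at this
    -- The constant is 14256 = 9 · 9 · 176: one 9 comes from `(γ / 3) ^ 2`, the other splits as 8 +
    -- 1, with 8 for `log 9 ≤ 8` in the net size and 1 for the confidence term.
    have h4 : d * Real.log 9 + Real.log (2 / δ) ≤ n * (γ / 3) ^ 2 / (176 * L ^ 4) := by
      have h9 : Real.log 9 ≤ 8 := by
        linarith [Real.log_le_sub_one_of_pos (by norm_num : (0 : ℝ) < 9)]
      have hd9 : d * Real.log 9 ≤ d * 8 := by gcongr
      rw [le_div_iff₀ (by positivity)]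
      nlinarith
    calc P.real B ≤ ∑ y ∈ N, P.real (bad y) := measureReal_biUnion_finset_le _ _
      _ ≤ ∑ _y ∈ N, 2 * Real.exp (-(n * (γ / 3) ^ 2 / (176 * L ^ 4))) :=
        Finset.sum_le_sum hbad
      _ = N.card * (2 * Real.exp (-(n * (γ / 3) ^ 2 / (176 * L ^ 4)))) := by
        rw [Finset.sum_const, nsmul_eq_mul]
      _ ≤ (9 : ℝ) ^ d * (2 * Real.exp (-(d * Real.log 9 + Real.log (2 / δ)))) := by
        gcongr
        exact_mod_cast hNcard
      _ = δ := by
        rw [neg_add, Real.exp_add, Real.exp_neg (Real.log _), Real.exp_log (by positivity),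
          Real.exp_neg, Real.exp_nat_mul, Real.exp_log (by norm_num)]
        field_simp
  -- The `z i` are only a.e. measurable, so `B` may fail to be measurable; its measurable hull has
  -- the same probability.
  refine ⟨(toMeasurable P B)ᶜ, (measurableSet_toMeasurable P B).compl, ?_, ?_⟩
  · rw [← ofReal_measureReal, probReal_compl_eq_one_sub (measurableSet_toMeasurable P B)]
    refine ENNReal.ofReal_le_ofReal ?_
    rw [Measure.real, measure_toMeasurable]
    exact sub_le_sub_left hB 1
  · intro ω hω θ
    have hωB : ω ∉ B := fun h => hω (subset_toMeasurable P B h)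
    let Z : Matrix (Fin n) (Fin d) ℝ := Matrix.of fun i => z i ω
    let M : Matrix (Fin d) (Fin d) ℝ := Zᵀ * Z - (n : ℝ) • 1
    have hM : ∀ y : Fin d → ℝ, y ⬝ᵥ M *ᵥ y = ∑ i, (z i ω ⬝ᵥ y) ^ 2 - n * (y ⬝ᵥ y) := by
      intro y
      rw [Matrix.sub_mulVec, dotProduct_sub, Matrix.smul_mulVec, Matrix.one_mulVec,
        dotProduct_smul, smul_eq_mul, ← Matrix.mulVec_mulVec, Matrix.dotProduct_mulVec,
        Matrix.vecMul_transpose]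
      simp [dotProduct, Matrix.mulVec, Z, sq]
    have := abs_quadForm_le_of_net (M := M) (by simp [M, Matrix.transpose_sub,
      Matrix.transpose_mul]) hN hcov (t := n * (γ / 3)) (fun y hy => ?_) θ
    · rw [hM] at this
      exact this.trans_eq (by ring)
    · rw [hM]
      by_contra hlt
      refine hωB (Set.mem_biUnion hy ?_)
      simp only [bad, Set.mem_ofPred_eq, Finset.sum_sub_distrib, Finset.sum_const,
        Finset.card_univ, Fintype.card_fin, nsmul_eq_mul]
      exact (not_le.1 hlt).le

/-! ### Sub-Gaussian norms and second moments of marginals -/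

/-- Strict inequality yields an admissible constant below `L`, and the exponential moment decreases
in the constant; whether the infimum is attained does not matter. -/
theorem lintegral_exp_le_two_of_psi2Norm_lt {Ω : Type*} [MeasurableSpace Ω] {μ : Measure Ω}
    {ξ : Ω → ℝ} {L : ℝ} (h : psi2Norm μ ξ < ENNReal.ofReal L) :
    ∫⁻ ω, ENNReal.ofReal (Real.exp (ξ ω ^ 2 / L ^ 2)) ∂μ ≤ 2 := by
  simp only [psi2Norm, iInf_lt_iff] at h
  obtain ⟨K, ⟨hK, h2⟩, hKL⟩ := h
  rw [← ENNReal.ofReal_coe_nnreal] at hKL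
  have hKL' := (ENNReal.ofReal_lt_ofReal_iff_of_nonneg K.2).1 hKL
  refine (lintegral_mono fun ω => ?_).trans h2
  have : (0 : ℝ) < K := hK
  gcongr
  exact hKL'.le

theorem exists_lintegral_exp_le_two {Ω : Type*} [MeasurableSpace Ω] {μ : Measure Ω}
    {ξ : Ω → ℝ} (h : psi2Norm μ ξ < ∞) :
    ∃ L : ℝ, 0 < L ∧ ∫⁻ ω, ENNReal.ofReal (Real.exp (ξ ω ^ 2 / L ^ 2)) ∂μ ≤ 2 := by
  simp only [psi2Norm, iInf_lt_iff] at h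
  obtain ⟨K, ⟨hK, h2⟩, -⟩ := h
  exact ⟨K, hK, h2⟩

theorem norm_toLp_sq {d : ℕ} (θ : Fin d → ℝ) : ‖WithLp.toLp 2 θ‖ ^ 2 = θ ⬝ᵥ θ := by
  rw [EuclideanSpace.norm_sq_eq]
  simp [dotProduct, sq]

theorem psi2Norm_dotProduct_le {Ω : Type*} [MeasurableSpace Ω] {μ : Measure Ω} {d : ℕ}
    (x : Ω → Fin d → ℝ) {θ : Fin d → ℝ} (hθ : θ ⬝ᵥ θ ≤ 1) :
    psi2Norm μ (fun ω => x ω ⬝ᵥ θ) ≤ psi2NormVec μ x := by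
  have : ‖WithLp.toLp 2 θ‖ ≤ 1 := by
    rwa [← sq_le_one_iff₀ (norm_nonneg _), norm_toLp_sq]
  exact le_iSup₂_of_le θ this le_rfl

theorem memLp_eval_of_subGaussian {d : ℕ} {p : Measure (Fin d → ℝ)}
    (hp : psi2NormVec p (fun x => x) < ∞) (i : Fin d) :
    MemLp (fun x : Fin d → ℝ => x i) 2 p := by
  have hm : Measurable fun x : Fin d → ℝ => x i := measurable_pi_apply i
  rw [memLp_two_iff_integrable_sq hm.aestronglyMeasurable]
  obtain ⟨L, hL, h⟩ := exists_lintegral_exp_le_two ((psi2Norm_dotProduct_le (μ := p) (fun x => x)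
    (θ := Pi.single i 1) (by simp)).trans_lt hp)
  simp only [dotProduct_single, mul_one] at h
  exact integrable_sq_of_psi2 hL hm.aemeasurable h

theorem memLp_dotProduct_of_subGaussian {d : ℕ} {p : Measure (Fin d → ℝ)}
    (hp : psi2NormVec p (fun x => x) < ∞) (u : Fin d → ℝ) :
    MemLp (fun x : Fin d → ℝ => x ⬝ᵥ u) 2 p := by
  unfold dotProduct
  refine memLp_finsetSum _ fun i _ => ?_
  simpa [mul_comm] using (memLp_eval_of_subGaussian hp i).const_mul (u i)

theorem integral_sq_dotProduct {d : ℕ} {p : Measure (Fin d → ℝ)}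
    (hp : psi2NormVec p (fun x => x) < ∞) (u : Fin d → ℝ) :
    ∫ x, (x ⬝ᵥ u) ^ 2 ∂p = u ⬝ᵥ secondMoment p *ᵥ u := by
  have hint : ∀ i j, Integrable (fun x : Fin d → ℝ => u i * (x i * x j * u j)) p := fun i j =>
    (((memLp_eval_of_subGaussian hp i).integrable_mul
      (memLp_eval_of_subGaussian hp j)).mul_const (u j)).const_mul (u i)
  have hexp : ∀ x : Fin d → ℝ, (x ⬝ᵥ u) ^ 2 = ∑ i, ∑ j, u i * (x i * x j * u j) := fun x => by
    rw [sq, dotProduct, Finset.sum_mul_sum]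
    exact Finset.sum_congr rfl fun i _ => Finset.sum_congr rfl fun j _ => by ring
  simp_rw [hexp]
  rw [integral_finsetSum _ fun i _ => integrable_finsetSum _ fun j _ => hint i j]
  simp only [dotProduct, Matrix.mulVec, Finset.mul_sum]
  refine Finset.sum_congr rfl fun i _ => ?_
  rw [integral_finsetSum _ fun j _ => hint i j]
  refine Finset.sum_congr rfl fun j _ => ?_
  rw [integral_const_mul, integral_mul_const]
  rfl

/-! ### Whitening by the inverse square root -/

section InvSqrt

open scoped MatrixOrder

variable {d : ℕ} {V : Matrix (Fin d) (Fin d) ℝ}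

theorem sqrt_transpose (V : Matrix (Fin d) (Fin d) ℝ) : (CFC.sqrt V)ᵀ = CFC.sqrt V := by
  have h := (IsSelfAdjoint.of_nonneg (CFC.sqrt_nonneg V)).star_eq
  rwa [Matrix.star_eq_conjTranspose, Matrix.conjTranspose_eq_transpose_of_trivial] at h

theorem sqrt_mul_sqrt_of_posDef (hV : V.PosDef) : CFC.sqrt V * CFC.sqrt V = V :=
  CFC.sqrt_mul_sqrt_self V hV.posSemidef.nonneg

theorem isUnit_det_sqrt (hV : V.PosDef) : IsUnit (CFC.sqrt V).det := by
  have h : (CFC.sqrt V).det * (CFC.sqrt V).det = V.det := by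
    rw [← Matrix.det_mul, sqrt_mul_sqrt_of_posDef hV]
  rw [isUnit_iff_ne_zero]
  intro h0
  rw [h0, zero_mul] at h
  exact hV.det_pos.ne h

theorem invSqrt_transpose (V : Matrix (Fin d) (Fin d) ℝ) : (invSqrt V)ᵀ = invSqrt V := by
  rw [invSqrt, Matrix.transpose_nonsing_inv, sqrt_transpose]

theorem invSqrt_mul_mul_invSqrt (hV : V.PosDef) : invSqrt V * V * invSqrt V = 1 := by
  have hu := isUnit_det_sqrt hV
  conv_lhs => enter [1, 2]; rw [← sqrt_mul_sqrt_of_posDef hV]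
  rw [invSqrt, ← mul_assoc, Matrix.nonsing_inv_mul _ hu, one_mul, Matrix.mul_nonsing_inv _ hu]

/-- The witness is `θ = V^{1/2} u`. It turns bounds in whitened coordinates, relative to `θ ⬝ᵥ θ`,
into bounds relative to the form of `V`. -/
theorem exists_invSqrt_mulVec_eq (hV : V.PosDef) (u : Fin d → ℝ) :
    ∃ θ : Fin d → ℝ, invSqrt V *ᵥ θ = u ∧ θ ⬝ᵥ θ = u ⬝ᵥ V *ᵥ u := by
  refine ⟨CFC.sqrt V *ᵥ u, ?_, ?_⟩
  · rw [invSqrt, Matrix.mulVec_mulVec, Matrix.nonsing_inv_mul _ (isUnit_det_sqrt hV),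
      Matrix.one_mulVec]
  · conv_rhs => rw [← sqrt_mul_sqrt_of_posDef hV]
    rw [← Matrix.mulVec_mulVec, Matrix.dotProduct_mulVec u (CFC.sqrt V),
      ← Matrix.mulVec_transpose, sqrt_transpose]

theorem invSqrt_mulVec_dotProduct (V : Matrix (Fin d) (Fin d) ℝ) (x θ : Fin d → ℝ) :
    (invSqrt V *ᵥ x) ⬝ᵥ θ = x ⬝ᵥ invSqrt V *ᵥ θ := by
  rw [Matrix.dotProduct_mulVec, ← Matrix.mulVec_transpose, invSqrt_transpose]

end InvSqrt

/-- Concentration of `Xᵀ X / n` around the second moment matrix, relative to the latter. -/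
theorem exists_event_secondMoment_le {Ω : Type*} [MeasurableSpace Ω] {P : Measure Ω}
    [IsProbabilityMeasure P] {d n : ℕ} {p : Measure (Fin d → ℝ)} (hp : IsSubGaussianInput p)
    {L : ℝ} (hL : 1 ≤ L)
    (hψ : psi2NormVec p (fun x => invSqrt (secondMoment p) *ᵥ x) < ENNReal.ofReal L)
    {x : Fin n → Ω → Fin d → ℝ} (hx : ∀ i, HasLaw (x i) p P) (hind : iIndepFun x P)
    {γ δ : ℝ} (hγ : 0 < γ) (hγ1 : γ < 1) (hδ : 0 < δ)
    (hn : 14256 * L ^ 4 * max ((d : ℝ) / γ ^ 2) (Real.log (2 / δ) / γ ^ 2) ≤ n) :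
    ∃ E : Set Ω, MeasurableSet E ∧ ENNReal.ofReal (1 - δ) ≤ P E ∧
      ∀ ω ∈ E, ∀ u : Fin d → ℝ, |∑ i, (x i ω ⬝ᵥ u) ^ 2 - n * (u ⬝ᵥ secondMoment p *ᵥ u)| ≤
        n * γ * (u ⬝ᵥ secondMoment p *ᵥ u) := by
  set R := invSqrt (secondMoment p) with hR
  have hdot : ∀ y θ : Fin d → ℝ, (R *ᵥ y) ⬝ᵥ θ = y ⬝ᵥ R *ᵥ θ :=
    invSqrt_mulVec_dotProduct (secondMoment p)
  have hmeas : Measurable fun y : Fin d → ℝ => R *ᵥ y := by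
    unfold Matrix.mulVec dotProduct
    fun_prop
  have hmdot : ∀ θ : Fin d → ℝ, Measurable fun y : Fin d → ℝ => y ⬝ᵥ θ := fun θ => by
    unfold dotProduct
    fun_prop
  obtain ⟨E, hE, hPE, hconc⟩ := exists_event_empirical_secondMoment (P := P)
    (z := fun i ω => R *ᵥ x i ω) (fun i => hmeas.comp_aemeasurable (hx i).aemeasurable)
    (hind.comp (fun _ y => R *ᵥ y) fun _ => hmeas) hL
    (fun i θ hθ => by
      have h := lintegral_exp_le_two_of_psi2Norm_lt
        ((psi2Norm_dotProduct_le (μ := p) (fun y => R *ᵥ y) hθ).trans_lt hψ)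
      have hm : Measurable fun y : Fin d → ℝ =>
          ENNReal.ofReal (Real.exp (((R *ᵥ y) ⬝ᵥ θ) ^ 2 / L ^ 2)) := by
        have := (hmdot θ).comp hmeas
        simp only [Function.comp_def] at this
        fun_prop
      rwa [← (hx i).lintegral_comp hm.aemeasurable] at h)
    (fun i θ => by
      have hm : Measurable fun y : Fin d → ℝ => ((R *ᵥ y) ⬝ᵥ θ) ^ 2 :=
        ((hmdot θ).comp hmeas).pow_const 2
      have h := (hx i).integral_comp hm.aestronglyMeasurable
      simp only [Function.comp_def] at h
      rw [h]
      simp_rw [hdot]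
      rw [integral_sq_dotProduct hp.subGaussian, hdot, Matrix.mulVec_mulVec,
        Matrix.mulVec_mulVec, hR, invSqrt_mul_mul_invSqrt hp.posDef, Matrix.one_mulVec])
    hγ hγ1 hδ hn
  refine ⟨E, hE, hPE, fun ω hω u => ?_⟩
  obtain ⟨θ, rfl, hθ⟩ := exists_invSqrt_mulVec_eq hp.posDef u
  rw [← hθ]
  simpa only [hdot] using hconc ω hω θ

/-! ### Excess risk and design objective as sums over pseudo-inverse columns -/

section OLS

variable {ι : Type*} [Fintype ι] {d : ℕ} {A : Matrix ι (Fin d) ℝ}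

/-- The closed form `w` has residual orthogonal to the range of `A`. By Pythagoras any minimizer has
the same fitted values, and `A` is injective because `AᵀA` is invertible. -/
theorem IsOLSEstimator.eq_inv_mulVec {What : (ι → ℝ) → Fin d → ℝ} (h : IsOLSEstimator A What)
    (hA : IsUnit (Aᵀ * A)) (y : ι → ℝ) : What y = ((Aᵀ * A)⁻¹ * Aᵀ) *ᵥ y := by
  have hdet : IsUnit (Aᵀ * A).det := (Matrix.isUnit_iff_isUnit_det _).1 hA
  set w := ((Aᵀ * A)⁻¹ * Aᵀ) *ᵥ y with hw
  set v := What y - w with hv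
  have hnormal : Aᵀ *ᵥ (y - A *ᵥ w) = 0 := by
    rw [Matrix.mulVec_sub, hw, Matrix.mulVec_mulVec, Matrix.mulVec_mulVec, ← Matrix.mul_assoc,
      Matrix.mul_nonsing_inv _ hdet, Matrix.one_mul, sub_self]
  have horth : (y - A *ᵥ w) ⬝ᵥ A *ᵥ v = 0 := by
    rw [Matrix.dotProduct_mulVec, ← Matrix.mulVec_transpose, hnormal, zero_dotProduct]
  have hle : (y - A *ᵥ What y) ⬝ᵥ (y - A *ᵥ What y) ≤ (y - A *ᵥ w) ⬝ᵥ (y - A *ᵥ w) := by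
    simpa [dotProduct, sq] using h y w
  have hsplit : y - A *ᵥ What y = (y - A *ᵥ w) - A *ᵥ v := by
    rw [hv, Matrix.mulVec_sub]; abel
  rw [hsplit, sub_dotProduct, dotProduct_sub (y - A *ᵥ w), dotProduct_sub (A *ᵥ v),
    dotProduct_comm (A *ᵥ v) (y - _), horth] at hle
  have hAv : A *ᵥ v = 0 := by
    have h0 : 0 ≤ (A *ᵥ v) ⬝ᵥ (A *ᵥ v) := by simpa using dotProduct_star_self_nonneg (A *ᵥ v)
    exact dotProduct_self_eq_zero.1 (by linarith)
  have : v = 0 := by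
    rw [← Matrix.one_mulVec v, ← Matrix.nonsing_inv_mul _ hdet, ← Matrix.mulVec_mulVec,
      ← Matrix.mulVec_mulVec, hAv, Matrix.mulVec_zero, Matrix.mulVec_zero]
  exact sub_eq_zero.1 this

/-- The pseudo-inverse is a left inverse of `A`, so the true parameter cancels and only a form
quadratic in the noise remains. -/
theorem IsOLSEstimator.predictionError_eq {What : (ι → ℝ) → Fin d → ℝ} (h : IsOLSEstimator A What)
    (hA : IsUnit (Aᵀ * A)) (w : Fin d → ℝ) (z : (ι → ℝ) × (Fin d → ℝ)) :
    predictionError A w What z =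
      ∑ i, ∑ j, z.1 i * z.1 j *
        ((z.2 ⬝ᵥ ((Aᵀ * A)⁻¹ * Aᵀ).col i) * (z.2 ⬝ᵥ ((Aᵀ * A)⁻¹ * Aᵀ).col j)) := by
  have hdet : IsUnit (Aᵀ * A).det := (Matrix.isUnit_iff_isUnit_det _).1 hA
  have hlin : w ⬝ᵥ z.2 - What (A *ᵥ w + z.1) ⬝ᵥ z.2 =
      -∑ i, z.1 i * (z.2 ⬝ᵥ ((Aᵀ * A)⁻¹ * Aᵀ).col i) := by
    rw [h.eq_inv_mulVec hA, Matrix.mulVec_add, Matrix.mulVec_mulVec, Matrix.mul_assoc,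
      Matrix.nonsing_inv_mul _ hdet, Matrix.one_mulVec, add_dotProduct, sub_add_cancel_left,
      dotProduct_comm, Matrix.dotProduct_mulVec, dotProduct_comm]
    rfl
  rw [predictionError, hlin, neg_sq, sq, Finset.sum_mul_sum]
  exact Finset.sum_congr rfl fun i _ => Finset.sum_congr rfl fun j _ => by ring

variable {σ : ℝ} {ρ : ι → Measure ℝ}

theorem memLp_eval_pi_noise (hρ : ∀ i, IsNoiseLaw σ (ρ i)) (i : ι) :
    MemLp (fun e : ι → ℝ => e i) 2 (Measure.pi ρ) := by
  have := fun i => (hρ i).isProbabilityMeasure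
  exact (hρ i).memLp.comp_measurePreserving (measurePreserving_eval ρ i)

theorem integral_eval_mul_eval_pi_noise [DecidableEq ι] (hρ : ∀ i, IsNoiseLaw σ (ρ i)) (i j : ι) :
    ∫ e, e i * e j ∂(Measure.pi ρ) = if i = j then σ ^ 2 else 0 := by
  have := fun i => (hρ i).isProbabilityMeasure
  split_ifs with hij
  · subst hij
    rw [← (hρ i).variance, ← (measurePreserving_eval ρ i).map_eq,
      integral_map (measurable_pi_apply i).aemeasurable (by fun_prop)]
    simp [sq]
  · have hind : iIndepFun (fun i (e : ι → ℝ) => e i) (Measure.pi ρ) :=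
      iIndepFun_pi (X := fun _ x => x) fun _ => aemeasurable_id
    rw [(hind.indepFun hij).integral_fun_mul_eq_mul_integral
      (measurable_pi_apply i).aestronglyMeasurable (measurable_pi_apply j).aestronglyMeasurable]
    have hi : ∫ e : ι → ℝ, e i ∂(Measure.pi ρ) = 0 := by
      rw [← (hρ i).mean]
      conv_rhs => rw [← (measurePreserving_eval ρ i).map_eq]
      rw [integral_map (measurable_pi_apply i).aemeasurable (by fun_prop)]
    rw [hi, zero_mul]

theorem IsOLSEstimator.excessRisk_eq {What : (ι → ℝ) → Fin d → ℝ} (h : IsOLSEstimator A What)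
    (hA : IsUnit (Aᵀ * A)) (hρ : ∀ i, IsNoiseLaw σ (ρ i)) {p : Measure (Fin d → ℝ)}
    (hp : IsSubGaussianInput p) (w : Fin d → ℝ) :
    Integrable (predictionError A w What) (noiseInputLaw ρ p) ∧
      excessRisk p ρ A w What = σ ^ 2 * ∑ i, ((Aᵀ * A)⁻¹ * Aᵀ).col i ⬝ᵥ
        secondMoment p *ᵥ ((Aᵀ * A)⁻¹ * Aᵀ).col i := by
  classical
  have := hp.isProbabilityMeasure
  have := fun i => (hρ i).isProbabilityMeasure
  set g := ((Aᵀ * A)⁻¹ * Aᵀ).col with hg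
  have hpe : predictionError A w What = fun z => ∑ i, ∑ j, z.1 i * z.1 j *
      ((z.2 ⬝ᵥ g i) * (z.2 ⬝ᵥ g j)) := funext (h.predictionError_eq hA w)
  have hint : ∀ i j, Integrable (fun z : (ι → ℝ) × (Fin d → ℝ) => z.1 i * z.1 j *
      ((z.2 ⬝ᵥ g i) * (z.2 ⬝ᵥ g j))) (noiseInputLaw ρ p) := fun i j =>
    ((memLp_eval_pi_noise hρ i).integrable_mul (memLp_eval_pi_noise hρ j)).mul_prod
      ((memLp_dotProduct_of_subGaussian hp.subGaussian (g i)).integrable_mul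
        (memLp_dotProduct_of_subGaussian hp.subGaussian (g j)))
  refine ⟨?_, ?_⟩
  · rw [hpe]
    exact integrable_finsetSum _ fun i _ => integrable_finsetSum _ fun j _ => hint i j
  · rw [excessRisk, hpe,
      integral_finsetSum _ fun i _ => integrable_finsetSum _ fun j _ => hint i j, Finset.mul_sum]
    refine Finset.sum_congr rfl fun i _ => ?_
    rw [integral_finsetSum _ fun j _ => hint i j]
    -- Noise and fresh input are independent, so each term factors, and the noise covariance leaves
    -- only the diagonal `i = j`.
    have hij : ∀ j, ∫ z, z.1 i * z.1 j * ((z.2 ⬝ᵥ g i) * (z.2 ⬝ᵥ g j)) ∂(noiseInputLaw ρ p) =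
        (if i = j then σ ^ 2 else 0) * ∫ x, (x ⬝ᵥ g i) * (x ⬝ᵥ g j) ∂p := fun j => by
      rw [← integral_eval_mul_eval_pi_noise hρ i j]
      exact integral_prod_mul (fun e : ι → ℝ => e i * e j)
        (fun x : Fin d → ℝ => (x ⬝ᵥ g i) * (x ⬝ᵥ g j))
    simp_rw [hij, ite_mul, zero_mul, Finset.sum_ite_eq, Finset.mem_univ, if_true]
    rw [← integral_sq_dotProduct hp.subGaussian]
    simp_rw [sq]

/-- `tr ((Aᵀ A)⁻¹ B)` in terms of the columns of the pseudo-inverse of `A`. -/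
theorem trace_inv_mul_eq_sum (hA : IsUnit (Aᵀ * A)) (B : Matrix (Fin d) (Fin d) ℝ) :
    ((Aᵀ * A)⁻¹ * B).trace =
      ∑ i, ((Aᵀ * A)⁻¹ * Aᵀ).col i ⬝ᵥ B *ᵥ ((Aᵀ * A)⁻¹ * Aᵀ).col i := by
  have hdet : IsUnit (Aᵀ * A).det := (Matrix.isUnit_iff_isUnit_det _).1 hA
  set G := (Aᵀ * A)⁻¹ * Aᵀ with hG
  have hGG : G * Gᵀ = (Aᵀ * A)⁻¹ := by
    rw [hG, Matrix.transpose_mul, Matrix.transpose_transpose, Matrix.transpose_nonsing_inv,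
      Matrix.transpose_mul, Matrix.transpose_transpose, Matrix.mul_assoc, ← Matrix.mul_assoc Aᵀ,
      Matrix.mul_nonsing_inv _ hdet, mul_one]
  rw [← hGG, Matrix.mul_assoc, Matrix.trace_mul_comm, Matrix.mul_assoc]
  simp [Matrix.trace, Matrix.mul_apply, dotProduct, Matrix.mulVec]

end OLS

theorem vObjective_eq {n d : ℕ} (X : Matrix (Fin n) (Fin d) ℝ) (S : Finset (Fin n))
    (hS : S.card ≠ 0) (hA : IsUnit ((selectRows X S)ᵀ * selectRows X S)) :
    vObjective X S = S.card / n * ∑ i,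
      (((selectRows X S)ᵀ * selectRows X S)⁻¹ * (selectRows X S)ᵀ).col i ⬝ᵥ
        (Xᵀ * X) *ᵥ (((selectRows X S)ᵀ * selectRows X S)⁻¹ * (selectRows X S)ᵀ).col i := by
  have hk : (S.card : ℝ) ≠ 0 := Nat.cast_ne_zero.2 hS
  set A := selectRows X S
  have hdet : IsUnit (Aᵀ * A).det := (Matrix.isUnit_iff_isUnit_det _).1 hA
  have hinv : ((1 / (S.card : ℝ)) • (Aᵀ * A))⁻¹ = (S.card : ℝ) • (Aᵀ * A)⁻¹ := by
    refine Matrix.inv_eq_right_inv ?_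
    rw [Matrix.smul_mul, Matrix.mul_smul, smul_smul, Matrix.mul_nonsing_inv _ hdet,
      one_div_mul_cancel hk, one_smul]
  have hT : ((Aᵀ * A)⁻¹)ᵀ = (Aᵀ * A)⁻¹ := by
    rw [Matrix.transpose_nonsing_inv, Matrix.transpose_mul, Matrix.transpose_transpose]
  rw [← trace_inv_mul_eq_sum hA, vObjective, matrixInner, hinv, Matrix.transpose_smul, hT,
    Matrix.smul_mul, Matrix.mul_smul, Matrix.trace_smul, Matrix.trace_smul, smul_eq_mul,
    smul_eq_mul]
  ring

end OptimalDesign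

theorem proposition2p1 (K : ℝ) (hK : 0 < K) :
    ∃ C : ℝ, 0 < C ∧
      ∀ (d n : ℕ) (p : Measure (Fin d → ℝ)), OptimalDesign.IsSubGaussianInput p →
      OptimalDesign.psi2NormVec p
        (fun x => OptimalDesign.invSqrt (OptimalDesign.secondMoment p) *ᵥ x) = ENNReal.ofReal K →
      ∀ (Ω : Type*) [MeasurableSpace Ω] (P : Measure Ω) [IsProbabilityMeasure P]
        (x : Fin n → Ω → Fin d → ℝ), (∀ i, HasLaw (x i) p P) → iIndepFun x P →
      ∀ γ δ : ℝ, 0 < γ → γ < 1 → 0 < δ → δ < 1 →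
      C * max ((d : ℝ) / γ ^ 2) (Real.log (2 / δ) / γ ^ 2) ≤ (n : ℝ) →
      ∃ E : Set Ω, MeasurableSet E ∧ ENNReal.ofReal (1 - δ) ≤ P E ∧
        ∀ ω ∈ E, ∀ X : Matrix (Fin n) (Fin d) ℝ, X = Matrix.of (fun i => x i ω) →
        ∀ S : Finset (Fin n), d < S.card → IsUnit (Xᵀ * X) →
          IsUnit ((OptimalDesign.selectRows X S)ᵀ * OptimalDesign.selectRows X S) →
        ∀ (w : Fin d → ℝ) (σ : ℝ) (ρ : S → Measure ℝ), (∀ i, OptimalDesign.IsNoiseLaw σ (ρ i)) →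
        ∀ What : (S → ℝ) → Fin d → ℝ,
          OptimalDesign.IsOLSEstimator (OptimalDesign.selectRows X S) What →
          Integrable (OptimalDesign.predictionError (OptimalDesign.selectRows X S) w What)
            (OptimalDesign.noiseInputLaw ρ p) ∧
          σ ^ 2 / ((1 + γ) * (S.card : ℝ)) * OptimalDesign.vObjective X S
            ≤ OptimalDesign.excessRisk p ρ (OptimalDesign.selectRows X S) w What ∧
          OptimalDesign.excessRisk p ρ (OptimalDesign.selectRows X S) w What
            ≤ σ ^ 2 / ((1 - γ) * (S.card : ℝ)) * OptimalDesign.vObjective X S := by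

  -- Taking `L = K + 1` secures both requirements of the concentration bound: `L ≥ 1`, and `L`
  -- strictly above the `ψ₂`-norm.
  refine ⟨14256 * (K + 1) ^ 4, by positivity, ?_⟩
  intro d n p hp hψ Ω _ P _ x hx hind γ δ hγ hγ1 hδ hδ1 hn
  obtain ⟨E, hE, hPE, hconc⟩ := OptimalDesign.exists_event_secondMoment_le hp
    (by linarith : 1 ≤ K + 1)
    (by rw [hψ]; exact (ENNReal.ofReal_lt_ofReal_iff (by linarith)).2 (by linarith))
    hx hind hγ hγ1 hδ hn
  refine ⟨E, hE, hPE, ?_⟩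
  rintro ω hω X rfl S hS - hA w σ ρ hρ What hols
  -- Since `d = 0` is allowed, it is the confidence term that forces `n > 0`.
  have hlog : 0 < Real.log (2 / δ) := Real.log_pos (by rw [lt_div_iff₀ hδ]; linarith)
  have hn0 : (0 : ℝ) < n := hn.trans_lt' <| mul_pos (by positivity) <|
    (div_pos hlog (pow_pos hγ 2)).trans_le (le_max_right _ _)
  have hk : (0 : ℝ) < S.card := Nat.cast_pos.2 (by omega)
  obtain ⟨hint, hrisk⟩ := hols.excessRisk_eq hA hρ hp w
  refine ⟨hint, ?_⟩
  rw [hrisk, OptimalDesign.vObjective_eq _ S (by omega) hA]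
  set X : Matrix (Fin n) (Fin d) ℝ := Matrix.of fun i => x i ω with hX
  set g := (((OptimalDesign.selectRows X S)ᵀ * OptimalDesign.selectRows X S)⁻¹ *
    (OptimalDesign.selectRows X S)ᵀ).col with hg
  have hquad : ∀ u : Fin d → ℝ, u ⬝ᵥ (Xᵀ * X) *ᵥ u = ∑ i, (x i ω ⬝ᵥ u) ^ 2 := by
    intro u
    rw [← Matrix.mulVec_mulVec, Matrix.dotProduct_mulVec, Matrix.vecMul_transpose]
    simp [dotProduct, Matrix.mulVec, hX, sq]
  set T := ∑ i, g i ⬝ᵥ OptimalDesign.secondMoment p *ᵥ g i with hT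
  set U := ∑ i, g i ⬝ᵥ (Xᵀ * X) *ᵥ g i with hU
  -- The event bounds the form in all directions simultaneously, so it applies to each `g i`,
  -- although these depend on `ω` and `S`; summing over `i` gives `(1 - γ) n T ≤ U ≤ (1 + γ) n T`.
  have hUT : |U - n * T| ≤ n * γ * T := by
    rw [hU, hT, Finset.mul_sum, Finset.mul_sum, ← Finset.sum_sub_distrib]
    refine (Finset.abs_sum_le_sum_abs _ _).trans (Finset.sum_le_sum fun i _ => ?_)
    rw [hquad]
    exact hconc ω hω (g i)
  obtain ⟨hlow, hup⟩ := abs_le.1 hUT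
  have hσ := sq_nonneg σ
  have h1γ : 0 < 1 - γ := by linarith
  have hscale : ∀ a : ℝ, a ≠ 0 → σ ^ 2 / (a * S.card) * (S.card / n * U) = σ ^ 2 * (U / (a * n)) :=
    fun a ha => by field_simp
  rw [hscale _ (by linarith : (0 : ℝ) < 1 + γ).ne', hscale _ h1γ.ne']
  constructor
  · gcongr
    rw [div_le_iff₀ (by positivity)]
    linarith
  · gcongr
    rw [le_div_iff₀ (by positivity)]
    linarith
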